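/- Let $X$ be a metric space and let $A,B\subseteq X$ be subsets with $X=A\cup B$, regarded as metric spaces with the restricted metric. Then $$ad(X)=\max\bigl(ad(A),ad(B)\bigr)$$ in $\{0,1,2,\dots\}\cup\{\infty\}$, where $ad$ is the minor asymptotic dimension, defined as follows. For a family $\mathcal U$ of subsets of a metric space $Y$, its multiplicity is the supremum over $y\in Y$ of the number of elements of $\mathcal U$ containing $y$, and its Lebesgue number is $$L(\mathcal U,Y)=\inf_{y\in Y}\ \sup_{U\in\mathcal U}\operatorname{dist}(y,Y\setminus U)\in[0,\infty],\qquad \operatorname{dist}(y,\emptyset)=\infty .$$ A family $\mathcal V$ refines $\mathcal U$ if every element of $\mathcal V$ is contained in some element of $\mathcal U$. For an integer $n\ge 0$, let $L^n(\mathcal U,Y)$ be the supremum of those $t\in[0,\infty]$ such that $\mathcal U$ has a refinement of multiplicity at most $n+1$ and Lebesgue number at least $t$. Then $ad(Y)$ is the smallest integer $n\ge 0$ such that $L^n(\mathcal U_k,Y)\to\infty$ as $k\to\infty$ for every sequence $(\mathcal U_k)$ of finite covers of $Y$ with $L(\mathcal U_k,Y)\to\infty$, and $ad(Y)=\infty$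 if there is no such $n$. -/

import Mathlib

open scoped ENNReal

namespace CoarseDim

/-- The local Lebesgue number `L_𝒰(x) = sup {dist(x, X \ U) | U ∈ 𝒰}`, with values in `[0, ∞]`.
The extended distance to the empty set is `∞`, so this is `∞` if `X ∈ 𝒰`. -/
noncomputable def localLebesgueNumber {X : Type*} [MetricSpace X] (𝒰 : Set (Set X)) (x : X) :
    ℝ≥0∞ :=
  ⨆ U ∈ 𝒰, Metric.infEDist x Uᶜ

/-- The Lebesgue number `L(𝒰, X) = inf {L_𝒰(x) | x ∈ X}` of a family of subsets of `X`. -/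
noncomputable def lebesgueNumber {X : Type*} [MetricSpace X] (𝒰 : Set (Set X)) : ℝ≥0∞ :=
  ⨅ x : X, localLebesgueNumber 𝒰 x

/-- The multiplicity function: the number of elements of the family containing `x`. -/
noncomputable def multiplicityAt {X : Type*} (𝒰 : Set (Set X)) (x : X) : ℕ∞ :=
  {U | U ∈ 𝒰 ∧ x ∈ U}.encard

/-- The (global) multiplicity of a family of subsets of `X`. -/
noncomputable def multiplicity {X : Type*} (𝒰 : Set (Set X)) : ℕ∞ :=
  ⨆ x : X, multiplicityAt 𝒰 x

/-- `𝒱` refines `𝒰`: every element of `𝒱` is contained in an element of `𝒰`. -/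
def Refines {X : Type*} (𝒱 𝒰 : Set (Set X)) : Prop :=
  ∀ V ∈ 𝒱, ∃ U ∈ 𝒰, V ⊆ U

/-- The `n`-th Lebesgue number `L^n(𝒰, X)`: the supremum of those `t ∈ [0, ∞]` such that `𝒰` has a
refinement of multiplicity at most `n + 1` and Lebesgue number at least `t`. -/
noncomputable def higherLebesgueNumber {X : Type*} [MetricSpace X] (n : ℕ) (𝒰 : Set (Set X)) :
    ℝ≥0∞ :=
  sSup {t : ℝ≥0∞ | ∃ 𝒱 : Set (Set X),
    Refines 𝒱 𝒰 ∧ multiplicity 𝒱 ≤ (n : ℕ∞) + 1 ∧ t ≤ lebesgueNumber 𝒱}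

/-- A finite cover of `X`. -/
def IsFiniteCover {X : Type*} (𝒰 : Set (Set X)) : Prop :=
  𝒰.Finite ∧ ⋃₀ 𝒰 = Set.univ

/-- The function `𝒰 ↦ L^n(𝒰, X)` is coarsely proper on the space of finite covers of `X`: it tends
to infinity along every sequence of finite covers that diverges to infinity, that is, whose
Lebesgue numbers tend to infinity. -/
def HigherLebesgueCoarselyProper (X : Type*) [MetricSpace X] (n : ℕ) : Prop :=
  ∀ 𝒰 : ℕ → Set (Set X), (∀ k, IsFiniteCover (𝒰 k)) →
    Filter.Tendsto (fun k => lebesgueNumber (𝒰 k)) Filter.atTop (nhds ⊤) →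
    Filter.Tendsto (fun k => higherLebesgueNumber n (𝒰 k)) Filter.atTop (nhds ⊤)

/-- The minor asymptotic dimension `ad(X)`: the smallest integer `n ≥ 0` such that
`𝒰 ↦ L^n(𝒰, X)` is coarsely proper on the space of finite covers of `X`, and `∞` if there is no
such `n`. -/
noncomputable def minorAsymptoticDim (X : Type*) [MetricSpace X] : ℕ∞ :=
  ⨅ (n : ℕ) (_ : HigherLebesgueCoarselyProper X n), (n : ℕ∞)

end CoarseDim

namespace CoarseDim

open scoped NNReal

universe u

/-! By `minorAsymptoticDim_le_iff`, `ad ≤ n` amounts to `UniformShrinking`. Its shrinkings keep the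
index set, so they compose, and a further shrinking never raises the multiplicity at a point. For a
union, shrink to bound the multiplicity on `A` while staying coarse on all of `X`
(`exists_shrinking_on`), then shrink again for `B`; the bound on `A` survives. For a subspace,
enlarge each `U i` by `Aᶜ`, shrink in `X` and restrict. -/

/-- Every finite family of subsets of `X` that is coarse enough at scale `s` can be shrunk,
index by index, to a family of multiplicity at most `n + 1` that is coarse at scale `r`. -/
def UniformShrinking (X : Type u) [MetricSpace X] (n : ℕ) : Prop :=
  ∀ r : ℝ≥0, ∃ s : ℝ≥0, ∀ (ι : Type u) [Finite ι] (U : ι → Set X),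
    (∀ x, ∃ i, Metric.eball x s ⊆ U i) →
    ∃ V : ι → Set X, (∀ i, V i ⊆ U i) ∧ (∀ x, {i | x ∈ V i}.encard ≤ (n : ℕ∞) + 1) ∧
      ∀ x, ∃ i, Metric.eball x r ⊆ V i

section

variable {X : Type u} [MetricSpace X]

theorem le_infEDist_compl_iff {x : X} {U : Set X} {t : ℝ≥0∞} :
    t ≤ Metric.infEDist x Uᶜ ↔ Metric.eball x t ⊆ U := by
  rw [Metric.le_infEDist]
  constructor
  · intro h y hy
    by_contra hyU
    rw [Metric.mem_eball, edist_comm] at hy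
    exact absurd (h y hyU) (not_le.2 hy)
  · intro h y hy
    by_contra hlt
    refine hy (h ?_)
    rw [Metric.mem_eball, edist_comm]
    exact not_le.1 hlt

theorem exists_eball_subset_of_lt_lebesgueNumber {𝒰 : Set (Set X)} {t : ℝ≥0∞}
    (h : t < lebesgueNumber 𝒰) (x : X) : ∃ U ∈ 𝒰, Metric.eball x t ⊆ U := by
  have hx : t < localLebesgueNumber 𝒰 x := h.trans_le (iInf_le _ x)
  simp only [localLebesgueNumber, lt_iSup_iff] at hx
  obtain ⟨U, hU, hlt⟩ := hx
  exact ⟨U, hU, le_infEDist_compl_iff.1 hlt.le⟩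

theorem le_lebesgueNumber {𝒰 : Set (Set X)} {t : ℝ≥0∞}
    (h : ∀ x, ∃ U ∈ 𝒰, Metric.eball x t ⊆ U) : t ≤ lebesgueNumber 𝒰 := by
  refine le_iInf fun x => ?_
  obtain ⟨U, hU, hx⟩ := h x
  exact (le_infEDist_compl_iff.2 hx).trans (le_iSup₂_of_le U hU le_rfl)

/-- A refinement can be replaced by a shrinking without raising the multiplicity. -/
theorem exists_shrinking_of_lt_higherLebesgueNumber {ι : Type*} {U : ι → Set X} {n : ℕ}
    {r : ℝ≥0∞} (h : r < higherLebesgueNumber n (Set.range U)) :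
    ∃ V : ι → Set X, (∀ i, V i ⊆ U i) ∧ (∀ x, {i | x ∈ V i}.encard ≤ (n : ℕ∞) + 1) ∧
      ∀ x, ∃ i, Metric.eball x r ⊆ V i := by
  obtain ⟨t, ⟨𝒱, href, hmult, ht⟩, hrt⟩ := lt_sSup_iff.1 h
  have href' : ∀ V : 𝒱, ∃ i, (V : Set X) ⊆ U i := fun V => by
    obtain ⟨_, ⟨i, rfl⟩, hi⟩ := href V V.2
    exact ⟨i, hi⟩
  choose f hf using href'
  -- Merge all members assigned to the same index: merging can only lower the number of sets through
  -- a point.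
  refine ⟨fun i => ⋃ V : {V : 𝒱 // f V = i}, (V.1 : Set X), fun i => ?_, fun x => ?_, fun x => ?_⟩
  · refine Set.iUnion_subset ?_
    rintro ⟨V, rfl⟩
    exact hf V
  · have hsub : {i | x ∈ ⋃ V : {V : 𝒱 // f V = i}, (V.1 : Set X)} ⊆
        f '' {V : 𝒱 | x ∈ (V : Set X)} := by
      intro i hi
      obtain ⟨⟨V, rfl⟩, hV⟩ := Set.mem_iUnion.1 hi
      exact ⟨V, hV, rfl⟩
    have himage : Subtype.val '' {V : 𝒱 | x ∈ (V : Set X)} ⊆ {V | V ∈ 𝒱 ∧ x ∈ V} := by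
      rintro _ ⟨V, hV, rfl⟩
      exact ⟨V.2, hV⟩
    calc _ ≤ _ := Set.encard_le_encard hsub
      _ ≤ {V : 𝒱 | x ∈ (V : Set X)}.encard := Set.encard_image_le _ _
      _ = _ := (Subtype.val_injective.encard_image _).symm
      _ ≤ multiplicityAt 𝒱 x := Set.encard_le_encard himage
      _ ≤ multiplicity 𝒱 := le_iSup (multiplicityAt 𝒱) x
      _ ≤ _ := hmult
  · obtain ⟨V, hV, hx⟩ := exists_eball_subset_of_lt_lebesgueNumber (hrt.trans_le ht) x
    exact ⟨f ⟨V, hV⟩, hx.trans (Set.subset_iUnion_of_subset ⟨⟨V, hV⟩, rfl⟩ subset_rfl)⟩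

theorem HigherLebesgueCoarselyProper.uniformShrinking {n : ℕ}
    (h : HigherLebesgueCoarselyProper X n) : UniformShrinking X n := by
  by_contra hcon
  unfold UniformShrinking at hcon
  push Not at hcon
  obtain ⟨r, hr⟩ := hcon
  -- Families that fail at scales `k + 1` form a sequence violating coarse properness; positive
  -- radii make each a cover.
  choose ι hι U hU hbad using fun k : ℕ => hr ((k : ℝ≥0) + 1)
  have hcover : ∀ k, IsFiniteCover (Set.range (U k)) := fun k => by
    have := hι k
    refine ⟨Set.finite_range _, Set.eq_univ_of_forall fun x => ?_⟩
    obtain ⟨i, hi⟩ := hU k x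
    exact ⟨U k i, ⟨i, rfl⟩, hi (Metric.mem_eball_self (by simp))⟩
  have hL : ∀ k : ℕ, (k : ℝ≥0∞) ≤ lebesgueNumber (Set.range (U k)) := fun k => by
    refine le_lebesgueNumber fun x => ?_
    obtain ⟨i, hi⟩ := hU k x
    exact ⟨U k i, ⟨i, rfl⟩, (Metric.eball_subset_eball (by simp)).trans hi⟩
  have hT := h (fun k => Set.range (U k)) hcover
    (tendsto_nhds_top_mono' ENNReal.tendsto_nat_nhds_top hL)
  obtain ⟨k, hk⟩ := (ENNReal.tendsto_nhds_top_iff_nnreal.1 hT r).exists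
  obtain ⟨V, hVU, hmult, hV⟩ := exists_shrinking_of_lt_higherLebesgueNumber hk
  obtain ⟨x, hx⟩ := hbad k V hVU hmult
  obtain ⟨i, hi⟩ := hV x
  exact hx i hi

theorem UniformShrinking.higherLebesgueCoarselyProper {n : ℕ} (h : UniformShrinking X n) :
    HigherLebesgueCoarselyProper X n := by
  intro 𝒰 hcover hL
  rw [ENNReal.tendsto_nhds_top_iff_nnreal] at hL ⊢
  intro r
  obtain ⟨s, hs⟩ := h (r + 1)
  filter_upwards [hL s] with k hk
  have : Finite (𝒰 k) := (hcover k).1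
  obtain ⟨V, hVU, hmult, hV⟩ := hs (𝒰 k) (fun U => (U : Set X)) fun x => by
    obtain ⟨U, hU, hx⟩ := exists_eball_subset_of_lt_lebesgueNumber hk x
    exact ⟨⟨U, hU⟩, hx⟩
  have hlt : (r : ℝ≥0∞) < ((r + 1 : ℝ≥0) : ℝ≥0∞) :=
    ENNReal.coe_lt_coe.2 (lt_add_of_pos_right r one_pos)
  refine hlt.trans_le (le_sSup ⟨Set.range V, ?_, ?_, ?_⟩)
  · rintro _ ⟨U, rfl⟩
    exact ⟨U, U.2, hVU U⟩
  · refine iSup_le fun x => ?_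
    have hsub : {W | W ∈ Set.range V ∧ x ∈ W} ⊆ V '' {U | x ∈ V U} := by
      rintro _ ⟨⟨U, rfl⟩, hx⟩
      exact ⟨U, hx, rfl⟩
    exact (Set.encard_le_encard hsub).trans ((Set.encard_image_le _ _).trans (hmult x))
  · refine le_lebesgueNumber fun x => ?_
    obtain ⟨U, hU⟩ := hV x
    exact ⟨V U, ⟨U, rfl⟩, hU⟩

theorem UniformShrinking.mono {m n : ℕ} (hmn : m ≤ n) (h : UniformShrinking X m) :
    UniformShrinking X n := by
  intro r
  obtain ⟨s, hs⟩ := h r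
  refine ⟨s, fun ι _ U hU => ?_⟩
  obtain ⟨V, hVU, hmult, hV⟩ := hs ι U hU
  exact ⟨V, hVU, fun x => (hmult x).trans (by gcongr), hV⟩

theorem minorAsymptoticDim_le_iff {n : ℕ} :
    minorAsymptoticDim X ≤ n ↔ UniformShrinking X n := by
  constructor
  · intro h
    -- A strict bound lets an admissible `m ≤ n` be extracted from the infimum.
    have hlt : minorAsymptoticDim X < ((n + 1 : ℕ) : ℕ∞) :=
      h.trans_lt (by exact_mod_cast Nat.lt_succ_self n)
    simp only [minorAsymptoticDim, iInf_lt_iff] at hlt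
    obtain ⟨m, hm, hmn⟩ := hlt
    exact hm.uniformShrinking.mono (Nat.lt_succ_iff.1 (by exact_mod_cast hmn))
  · intro h
    exact iInf₂_le n h.higherLebesgueCoarselyProper

theorem UniformShrinking.subset {n : ℕ} (h : UniformShrinking X n) (A : Set X) :
    UniformShrinking A n := by
  intro r
  obtain ⟨s, hs⟩ := h r
  -- An `s`-ball of `X` either misses `A` or lies in the `2s`-ball of a point of `A`.
  refine ⟨s + s, fun ι _ U hU => ?_⟩
  -- If `A` is empty, `ι` may be empty too.
  rcases isEmpty_or_nonempty A with hA | ⟨⟨a₀⟩⟩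
  · exact ⟨fun _ => ∅, fun _ => Set.empty_subset _, fun x => hA.elim x, fun x => hA.elim x⟩
  obtain ⟨V, hVU, hmult, hV⟩ := hs ι (fun i => Subtype.val '' U i ∪ Aᶜ) fun x => by
    by_cases hx : ∃ a : A, edist (a : X) x < s
    · obtain ⟨a, ha⟩ := hx
      obtain ⟨i, hi⟩ := hU a
      refine ⟨i, fun y hy => ?_⟩
      by_cases hyA : y ∈ A
      · refine Or.inl ⟨⟨y, hyA⟩, hi ?_, rfl⟩
        rw [Metric.mem_eball, Subtype.edist_eq, ENNReal.coe_add]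
        rw [edist_comm] at ha
        exact (edist_triangle y x a).trans_lt (ENNReal.add_lt_add hy ha)
      · exact Or.inr hyA
    · obtain ⟨i, -⟩ := hU a₀
      exact ⟨i, fun y hy => Or.inr fun hyA => hx ⟨⟨y, hyA⟩, hy⟩⟩
  refine ⟨fun i => Subtype.val ⁻¹' V i, fun i a ha => ?_, fun a => hmult a, fun a => ?_⟩
  · rcases hVU i ha with ⟨b, hb, hba⟩ | hna
    · rwa [← Subtype.ext hba]
    · exact absurd a.2 hna
  · obtain ⟨i, hi⟩ := hV a
    exact ⟨i, fun b hb => hi hb⟩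

/-- Shrinking a coarse family of subsets of `X` so that its multiplicity becomes small on `A`. -/
theorem UniformShrinking.exists_shrinking_on {n : ℕ} {A : Set X} (h : UniformShrinking A n)
    (r : ℝ≥0) : ∃ s : ℝ≥0, ∀ (ι : Type u) [Finite ι] (U : ι → Set X),
      (∀ x, ∃ i, Metric.eball x s ⊆ U i) →
      ∃ V : ι → Set X, (∀ i, V i ⊆ U i) ∧ (∀ x ∈ A, {i | x ∈ V i}.encard ≤ (n : ℕ∞) + 1) ∧
        ∀ x, ∃ i, Metric.eball x r ⊆ V i := by
  -- An `r`-ball whose centre is within `r` of `a ∈ A` lies in the `2r`-ball of `a`; the `+ 1` keeps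
  -- the radius positive when `r = 0`.
  obtain ⟨s, hs⟩ := h (r + r + 1)
  refine ⟨(r + r + 1) + s, fun ι _ U hU => ?_⟩
  have hpos : (0 : ℝ≥0∞) < ((r + r + 1 : ℝ≥0) : ℝ≥0∞) := by simp
  obtain ⟨V, hVU, hmult, hV⟩ :=
    hs ι (fun i => {a : A | Metric.eball (a : X) (r + r + 1 : ℝ≥0) ⊆ U i}) fun a => by
      obtain ⟨i, hi⟩ := hU a
      refine ⟨i, fun b hb y hy => hi ?_⟩
      rw [Metric.mem_eball, ENNReal.coe_add]
      exact (edist_triangle y b a).trans_lt (ENNReal.add_lt_add hy hb)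
  -- Only the trace on `A` is shrunk. As `V i` lies in the eroded `U i`, balls around its points
  -- that leave `A` stay in `U i`.
  refine ⟨fun i => Subtype.val '' V i ∪ (U i \ A), fun i => ?_, fun x hx => ?_, fun x => ?_⟩
  · rintro x (⟨a, ha, rfl⟩ | hx)
    · exact hVU i ha (Metric.mem_eball_self hpos)
    · exact hx.1
  · refine (Set.encard_le_encard ?_).trans (hmult ⟨x, hx⟩)
    rintro i (⟨a, ha, rfl⟩ | hi)
    · exact ha
    · exact absurd hx hi.2
  · by_cases hx : ∃ a : A, edist (a : X) x < r
    · obtain ⟨a, ha⟩ := hx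
      obtain ⟨i, hi⟩ := hV a
      rw [edist_comm] at ha
      refine ⟨i, fun y hy => ?_⟩
      have hya : edist y (a : X) < ((r + r + 1 : ℝ≥0) : ℝ≥0∞) :=
        calc edist y (a : X) ≤ edist y x + edist x a := edist_triangle _ _ _
          _ < r + r := ENNReal.add_lt_add hy ha
          _ ≤ _ := by push_cast; exact le_self_add
      by_cases hyA : y ∈ A
      · exact Or.inl ⟨⟨y, hyA⟩, hi hya, rfl⟩
      · exact Or.inr ⟨hVU i (hi (Metric.mem_eball_self hpos)) hya, hyA⟩
    · obtain ⟨i, hi⟩ := hU x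
      refine ⟨i, fun y hy => Or.inr ⟨hi (Metric.eball_subset_eball ?_ hy), fun hyA =>
        hx ⟨⟨y, hyA⟩, hy⟩⟩⟩
      push_cast
      rw [add_assoc, add_assoc]
      exact le_self_add

theorem UniformShrinking.union {n : ℕ} {A B : Set X} (hAB : A ∪ B = Set.univ)
    (hA : UniformShrinking A n) (hB : UniformShrinking B n) : UniformShrinking X n := by
  intro r
  obtain ⟨s, hs⟩ := hB.exists_shrinking_on r
  obtain ⟨t, ht⟩ := hA.exists_shrinking_on s
  refine ⟨t, fun ι _ U hU => ?_⟩
  obtain ⟨V, hVU, hVmult, hV⟩ := ht ι U hU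
  obtain ⟨W, hWV, hWmult, hW⟩ := hs ι V hV
  refine ⟨W, fun i => (hWV i).trans (hVU i), fun x => ?_, hW⟩
  rcases (hAB ▸ Set.mem_univ x : x ∈ A ∪ B) with hx | hx
  · exact (Set.encard_le_encard fun i hi => hWV i hi).trans (hVmult x hx)
  · exact hWmult x hx

end

theorem le_of_forall_le_natCast {a b : ℕ∞} (h : ∀ n : ℕ, b ≤ n → a ≤ n) : a ≤ b := by
  induction b using ENat.recTopCoe with
  | top => exact le_top
  | coe n => exact h n le_rfl

end CoarseDim

theorem mainTheorem11 {X : Type*} [MetricSpace X] (A B : Set X) (hAB : A ∪ B = Set.univ) :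
    CoarseDim.minorAsymptoticDim X =
      max (CoarseDim.minorAsymptoticDim A) (CoarseDim.minorAsymptoticDim B) := by
  refine le_antisymm (CoarseDim.le_of_forall_le_natCast fun n h => ?_)
    (CoarseDim.le_of_forall_le_natCast fun n h => ?_)
  · rw [max_le_iff, CoarseDim.minorAsymptoticDim_le_iff, CoarseDim.minorAsymptoticDim_le_iff] at h
    exact CoarseDim.minorAsymptoticDim_le_iff.2 (CoarseDim.UniformShrinking.union hAB h.1 h.2)
  · rw [CoarseDim.minorAsymptoticDim_le_iff] at h
    exact max_le (CoarseDim.minorAsymptoticDim_le_iff.2 (h.subset A))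
      (CoarseDim.minorAsymptoticDim_le_iff.2 (h.subset B))
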